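/- Let $d$ be a positive integer. Let $I_d$ be the space of smooth functions $\phi:\mathbb{R}\to\mathbb{C}$ such that the function $x\mapsto i^{d+1}x^{-d-1}\phi(-1/x)$ on $\mathbb{R}\setminus\{0\}$ extends to a smooth function on $\mathbb{R}$. For $\phi\in I_d$ define a function $M_d(\phi)$ on $\mathbb{R}\setminus\{0\}$ by $$M_d(\phi)(y)=|y|^{(1-d)/2}\,\hat\phi(y),\qquad \hat\phi(y)=(2\pi)^{-1/2}\int_{-\infty}^{\infty}\phi(x)e^{-ixy}\,dx,$$ and let $\tilde S_d=M_d(I_d)$. Then $\tilde S_d$ is exactly the set of smooth functions $f:\mathbb{R}\setminus\{0\}\to\mathbb{C}$ such that 1. $f$ and all its derivatives are rapidly decreasing at $\pm\infty$, that is, for all integers $k,n\ge 0$, $f^{(k)}(y)=O(|y|^{-n})$ as $|y|\to\infty$; and 2. the function $|y|^{(d-1)/2}f(y)$, with a suitable value at $y=0$, is smooth on the right and on the left at $y=0$ (its restrictions to $[0,\infty)$ and to $(-\infty,0]$ are smooth) and has $d-1$ continuous derivatives at $y=0$ (when $d=1$ this last condition means that it is continuous at $y=0$). -/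

import Mathlib

open scoped ContDiff

noncomputable section

/-- The punctured real line. -/
abbrev PuncturedLine : Type := {y : ℝ // y ≠ 0}

/-- The operator `W_d(φ)(x) = i^(d+1) x^(-d-1) φ(-1/x)`; only its values at `x ≠ 0` are meaningful. -/
def weylOp (d : ℕ) (φ : ℝ → ℂ) (x : ℝ) : ℂ :=
  Complex.I ^ (d + 1) * ((x : ℂ) ^ (d + 1))⁻¹ * φ (-1 / x)

/-- The induced space `I_d`: the smooth functions `φ` on `ℝ` such that `W_d(φ)`, which is given by
a formula on `ℝ ∖ {0}`, extends to a smooth function on `ℝ`. -/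
def inducedSpace (d : ℕ) : Set (ℝ → ℂ) :=
  {φ | ContDiff ℝ ∞ φ ∧ ∃ ψ : ℝ → ℂ, ContDiff ℝ ∞ ψ ∧ ∀ x : ℝ, x ≠ 0 → ψ x = weylOp d φ x}

/-- The unitary Fourier transform `(2π)^(-1/2) ∫ φ(x) e^(-ixy) dx`. -/
def unitaryFourier (φ : ℝ → ℂ) (y : ℝ) : ℂ :=
  (((2 * Real.pi) ^ (-(1 / 2) : ℝ) : ℝ) : ℂ) *
    ∫ x : ℝ, φ x * Complex.exp (-Complex.I * (x : ℂ) * (y : ℂ))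

/-- The map `M_d(φ)(y) = |y|^((1-d)/2) φ̂(y)`, a function on `ℝ ∖ {0}`. -/
def kirillovMap (d : ℕ) (φ : ℝ → ℂ) : PuncturedLine → ℂ :=
  fun y => ((|(y : ℝ)| ^ ((1 - (d : ℝ)) / 2) : ℝ) : ℂ) * unitaryFourier φ (y : ℝ)

/-- The image of the induced space under `M_d`. -/
def kirillovImage (d : ℕ) : Set (PuncturedLine → ℂ) :=
  kirillovMap d '' inducedSpace d

/-- A function on `ℝ ∖ {0}` as a function on `ℝ`, with the value `0` at `0`. It serves only to
speak of derivatives away from `0`, where they do not depend on the value at `0`. -/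
def extendByZero (f : PuncturedLine → ℂ) (y : ℝ) : ℂ :=
  open Classical in if h : y ≠ 0 then f ⟨y, h⟩ else 0

/-- `f` is smooth on `ℝ ∖ {0}`. -/
def SmoothOffZero (f : PuncturedLine → ℂ) : Prop :=
  ContDiffOn ℝ ∞ (extendByZero f) {0}ᶜ

/-- `f` and all its derivatives are rapidly decreasing at `+∞` and `-∞`:
`f^(k)(y) = O(|y|^(-n))` as `|y| → ∞`, for all `k` and `n`. -/
def RapidlyDecreasing (f : PuncturedLine → ℂ) : Prop :=
  ∀ k n : ℕ, ∃ C R : ℝ, ∀ y : ℝ, R ≤ |y| →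
    |y| ^ n * ‖iteratedDeriv k (extendByZero f) y‖ ≤ C

/-- The function `|y|^((d-1)/2) f(y)`, with a suitable (then unique) value at `y = 0`, is smooth on
the right and on the left at `0` and has `d - 1` continuous derivatives at `0` (for `d = 1`: it is
continuous at `0`). -/
def RegularAtZero (d : ℕ) (f : PuncturedLine → ℂ) : Prop :=
  ∃ g : ℝ → ℂ,
    (∀ y : PuncturedLine, g (y : ℝ) = ((|(y : ℝ)| ^ (((d : ℝ) - 1) / 2) : ℝ) : ℂ) * f y) ∧
    ContDiffOn ℝ ∞ g (Set.Ici 0) ∧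
    ContDiffOn ℝ ∞ g (Set.Iic 0) ∧
    ContDiffAt ℝ ((d - 1 : ℕ) : WithTop ℕ∞) g 0

end

open MeasureTheory Set Filter Topology Complex FourierTransform

/-- The oscillatory integral `∫ g(y) e^(ixy) dμ(y)`. -/
noncomputable def oscIntegral (μ : Measure ℝ) (g : ℝ → ℂ) (x : ℝ) : ℂ :=
  ∫ y, g y * cexp (I * x * y) ∂μ

lemma norm_cexp_I_mul_mul (x y : ℝ) : ‖cexp (I * x * y)‖ = 1 := by
  rw [show I * (x : ℂ) * y = ((x * y : ℝ) : ℂ) * I by push_cast; ring]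
  exact norm_exp_ofReal_mul_I _

lemma Integrable.mul_cexp {μ : Measure ℝ} {g : ℝ → ℂ} (hg : Integrable g μ) (x : ℝ) :
    Integrable (fun y : ℝ => g y * cexp (I * x * y)) μ := by
  refine hg.norm.mono' (hg.aestronglyMeasurable.mul ?_) (ae_of_all _ fun y => ?_)
  · exact (by fun_prop : Continuous fun y : ℝ => cexp (I * x * y)).aestronglyMeasurable
  · rw [norm_mul, norm_cexp_I_mul_mul, mul_one]

lemma norm_oscIntegral_le (μ : Measure ℝ) (g : ℝ → ℂ) (x : ℝ) :
    ‖oscIntegral μ g x‖ ≤ ∫ y, ‖g y‖ ∂μ := by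
  refine (norm_integral_le_integral_norm _).trans_eq ?_
  simp only [norm_mul, norm_cexp_I_mul_mul, mul_one]

lemma continuous_oscIntegral {μ : Measure ℝ} {g : ℝ → ℂ} (hg : Integrable g μ) :
    Continuous (oscIntegral μ g) := by
  refine continuous_of_dominated (fun x => (Integrable.mul_cexp hg x).aestronglyMeasurable)
    (bound := fun y => ‖g y‖) (fun x => ae_of_all _ fun y => ?_) hg.norm
    (ae_of_all _ fun y => by fun_prop)
  rw [norm_mul, norm_cexp_I_mul_mul, mul_one]

lemma hasDerivAt_oscIntegral {μ : Measure ℝ} {g : ℝ → ℂ} (hg : Integrable g μ)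
    (hg' : Integrable (fun y : ℝ => (y : ℂ) * g y) μ) (x : ℝ) :
    HasDerivAt (oscIntegral μ g) (oscIntegral μ (fun y => I * ((y : ℂ) * g y)) x) x := by
  refine (hasDerivAt_integral_of_dominated_loc_of_deriv_le (F := fun (x y : ℝ) => g y * cexp (I * x * y))
    (F' := fun (x y : ℝ) => I * ((y : ℂ) * g y) * cexp (I * x * y))
    (bound := fun y : ℝ => ‖(y : ℂ) * g y‖) univ_mem
    (Eventually.of_forall fun x => (Integrable.mul_cexp hg x).aestronglyMeasurable)
    (Integrable.mul_cexp hg x) (Integrable.mul_cexp (hg'.const_mul I) x).aestronglyMeasurable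
    (ae_of_all _ fun y x _ => ?_) hg'.norm (ae_of_all _ fun y x _ => ?_)).2
  · rw [norm_mul, norm_cexp_I_mul_mul, mul_one, norm_mul, norm_I, one_mul]
  · have h : HasDerivAt (fun x : ℝ => I * (x : ℂ) * y) (I * 1 * y) x :=
      ((hasDerivAt_id x).ofReal_comp.const_mul I).mul_const _
    exact (h.cexp.const_mul (g y)).congr_deriv (by ring)

lemma oscIntegral_add {μ : Measure ℝ} {g h : ℝ → ℂ} (hg : Integrable g μ) (hh : Integrable h μ)
    (x : ℝ) : oscIntegral μ (fun y => g y + h y) x = oscIntegral μ g x + oscIntegral μ h x := by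
  simp only [oscIntegral, add_mul]
  exact integral_add (Integrable.mul_cexp hg x) (Integrable.mul_cexp hh x)

lemma oscIntegral_const_mul (μ : Measure ℝ) (c : ℂ) (g : ℝ → ℂ) (x : ℝ) :
    oscIntegral μ (fun y => c * g y) x = c * oscIntegral μ g x := by
  simp only [oscIntegral, mul_assoc]
  exact integral_const_mul _ _

lemma unitaryFourier_eq (φ : ℝ → ℂ) (y : ℝ) :
    unitaryFourier φ y =
      (((2 * Real.pi) ^ (-(1 / 2) : ℝ) : ℝ) : ℂ) * oscIntegral volume φ (-y) := by
  unfold unitaryFourier oscIntegral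
  congr 1
  refine integral_congr_ae (ae_of_all _ fun x => ?_)
  simp only
  congr 2
  push_cast
  ring

/-- Smooth functions of the form `x^(-k) ψ(1/x)` off zero, with `ψ` smooth on the line. -/
def InvSmooth (k : ℕ) (φ : ℝ → ℂ) : Prop :=
  ContDiff ℝ ∞ φ ∧
    ∃ ψ : ℝ → ℂ, ContDiff ℝ ∞ ψ ∧ ∀ x : ℝ, x ≠ 0 → φ x = ((x : ℂ) ^ k)⁻¹ * ψ x⁻¹

lemma mem_inducedSpace_iff (d : ℕ) (φ : ℝ → ℂ) : φ ∈ inducedSpace d ↔ InvSmooth (d + 1) φ := by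
  refine and_congr_right fun _ => ⟨?_, ?_⟩
  · rintro ⟨ψ, hψ, h⟩
    refine ⟨fun t => I ^ (d + 1) * ψ (-t), contDiff_const.mul (hψ.comp contDiff_neg), fun x hx => ?_⟩
    have hx' : (x : ℂ) ≠ 0 := ofReal_ne_zero.2 hx
    have e : -1 / -x⁻¹ = x := by field_simp
    simp only [h (-x⁻¹) (by simpa using hx), weylOp, e]
    push_cast
    rw [neg_pow, inv_pow, mul_inv, inv_inv,
      show ((-1 : ℂ) ^ (d + 1))⁻¹ = (-1) ^ (d + 1) by rw [← inv_pow, inv_neg_one]]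
    have : (I ^ (d + 1) * I ^ (d + 1) * (-1) ^ (d + 1) : ℂ) = 1 := by
      rw [← mul_pow, ← mul_pow]; simp
    field_simp
    linear_combination -φ x * this
  · rintro ⟨ψ, hψ, h⟩
    refine ⟨fun t => (-I) ^ (d + 1) * ψ (-t), contDiff_const.mul (hψ.comp contDiff_neg),
      fun x hx => ?_⟩
    have hx' : (x : ℂ) ≠ 0 := ofReal_ne_zero.2 hx
    rw [weylOp, h (-1 / x) (div_ne_zero (by norm_num) hx)]
    have e : (-1 / x)⁻¹ = -x := by field_simp
    rw [e]
    push_cast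
    rw [div_pow, neg_pow I]
    have : ((-1) ^ (d + 1) * (-1) ^ (d + 1) : ℂ) = 1 := by
      rw [← mul_pow]; simp
    field_simp
    linear_combination ψ (-x) * this

namespace InvSmooth

lemma mono {k : ℕ} {φ : ℝ → ℂ} (h : InvSmooth (k + 1) φ) : InvSmooth k φ := by
  obtain ⟨h1, ψ, hψ, h⟩ := h
  refine ⟨h1, fun t => t * ψ t, ofRealCLM.contDiff.mul hψ, fun x hx => ?_⟩
  have hx' : (x : ℂ) ≠ 0 := ofReal_ne_zero.2 hx
  rw [h x hx]
  push_cast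
  field_simp
  ring

lemma of_le {k l : ℕ} (hkl : k ≤ l) {φ : ℝ → ℂ} (h : InvSmooth l φ) : InvSmooth k φ := by
  induction hkl with
  | refl => exact h
  | step _ ih => exact ih h.mono

lemma mul_id {k : ℕ} {φ : ℝ → ℂ} (h : InvSmooth (k + 1) φ) :
    InvSmooth k (fun x => (x : ℂ) * φ x) := by
  obtain ⟨h1, ψ, hψ, h⟩ := h
  refine ⟨ofRealCLM.contDiff.mul h1, ψ, hψ, fun x hx => ?_⟩
  have hx' : (x : ℂ) ≠ 0 := ofReal_ne_zero.2 hx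
  simp only [h x hx]
  field_simp
  ring

lemma add {k : ℕ} {φ χ : ℝ → ℂ} (hφ : InvSmooth k φ) (hχ : InvSmooth k χ) :
    InvSmooth k (fun x => φ x + χ x) := by
  obtain ⟨h1, ψ, hψ, h⟩ := hφ
  obtain ⟨h1', ψ', hψ', h'⟩ := hχ
  refine ⟨h1.add h1', fun t => ψ t + ψ' t, hψ.add hψ', fun x hx => ?_⟩
  simp only [h x hx, h' x hx, mul_add]

lemma const_mul {k : ℕ} {φ : ℝ → ℂ} (hφ : InvSmooth k φ) (c : ℂ) :
    InvSmooth k (fun x => c * φ x) := by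
  obtain ⟨h1, ψ, hψ, h⟩ := hφ
  refine ⟨contDiff_const.mul h1, fun t => c * ψ t, contDiff_const.mul hψ, fun x hx => ?_⟩
  simp only [h x hx]; ring

lemma deriv {k : ℕ} {φ : ℝ → ℂ} (hφ : InvSmooth k φ) : InvSmooth (k + 1) (deriv φ) := by
  obtain ⟨h1, ψ, hψ, h⟩ := hφ
  have hψ' := (contDiff_infty_iff_deriv.1 hψ)
  refine ⟨(contDiff_infty_iff_deriv.1 h1).2, fun t => -(k * ψ t + t * _root_.deriv ψ t),
    ((contDiff_const.mul hψ).add (ofRealCLM.contDiff.mul hψ'.2)).neg, fun x hx => ?_⟩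
  have hx' : (x : ℂ) ≠ 0 := ofReal_ne_zero.2 hx
  have hev : φ =ᶠ[𝓝 x] fun x => ((x : ℂ) ^ k)⁻¹ * ψ x⁻¹ := by
    filter_upwards [isOpen_ne.mem_nhds hx] with y hy using h y hy
  rw [hev.deriv_eq]
  have d1 : HasDerivAt (fun x : ℝ => ((x : ℂ) ^ k)⁻¹) (-(k * (x : ℂ) ^ (k - 1) * 1) / ((x : ℂ) ^ k) ^ 2) x :=
    ((hasDerivAt_id x).ofReal_comp.pow k).inv (pow_ne_zero _ hx')
  have d2 : HasDerivAt (fun x : ℝ => ψ x⁻¹) ((-(x ^ 2)⁻¹ : ℝ) • _root_.deriv ψ x⁻¹) x :=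
    HasDerivAt.scomp x (hψ'.1 x⁻¹).hasDerivAt (hasDerivAt_inv hx)
  rw [(HasDerivAt.fun_mul d1 d2).deriv, real_smul]
  push_cast
  rcases k with _ | k
  · simp; field_simp
  · simp only [Nat.add_sub_cancel]
    field_simp
    push_cast
    ring

lemma integrable {φ : ℝ → ℂ} (h : InvSmooth 2 φ) : Integrable φ := by
  obtain ⟨h1, ψ, hψ, h⟩ := h
  refine h1.continuous.locallyIntegrable.integrable_of_isBigO_cocompact
    (g := fun x => (1 + x ^ 2)⁻¹) ?_ (integrable_inv_one_add_sq.integrableAtFilter _)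
  obtain ⟨C, hC⟩ := (isCompact_Icc (a := (-1 : ℝ)) (b := 1)).exists_bound_of_continuousOn
    hψ.continuous.continuousOn
  refine Asymptotics.IsBigO.of_bound (2 * C) ?_
  have : ∀ᶠ x : ℝ in cocompact ℝ, 1 ≤ ‖x‖ := tendsto_norm_cocompact_atTop.eventually_ge_atTop 1
  filter_upwards [this] with x hx
  rw [Real.norm_eq_abs] at hx
  have hx0 : x ≠ 0 := by rintro rfl; norm_num at hx
  have hx2 : 1 ≤ x ^ 2 := by rw [← sq_abs]; nlinarith
  have hb := hC x⁻¹ (by rw [mem_Icc, ← abs_le, abs_inv]; exact inv_le_one_of_one_le₀ hx)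
  rw [h x hx0, norm_mul, norm_inv, norm_pow, norm_real, Real.norm_eq_abs, sq_abs, norm_inv,
    Real.norm_of_nonneg (by positivity : (0 : ℝ) ≤ 1 + x ^ 2)]
  have hC0 := (norm_nonneg _).trans hb
  calc (x ^ 2)⁻¹ * ‖ψ x⁻¹‖ ≤ (x ^ 2)⁻¹ * C := by gcongr
    _ = 2 * C * (2 * x ^ 2)⁻¹ := by field_simp
    _ ≤ 2 * C * (1 + x ^ 2)⁻¹ := by gcongr; linarith

/-- Integration by parts. -/
lemma oscIntegral_deriv {φ : ℝ → ℂ} (h : InvSmooth 2 φ) (x : ℝ) :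
    oscIntegral volume (_root_.deriv φ) x = -I * x * oscIntegral volume φ x := by
  have hi := h.integrable
  have hi' := h.deriv.mono.integrable
  have key := integral_eq_zero_of_hasDerivAt_of_integrable
    (f := fun y : ℝ => φ y * cexp (I * x * y))
    (f' := fun y : ℝ => _root_.deriv φ y * cexp (I * x * y) + (I * x) * (φ y * cexp (I * x * y)))
    (fun y => ?_) ((Integrable.mul_cexp hi' x).add ((Integrable.mul_cexp hi x).const_mul _))
    (Integrable.mul_cexp hi x)
  · rw [integral_add (Integrable.mul_cexp hi' x) ((Integrable.mul_cexp hi x).const_mul _),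
      integral_const_mul] at key
    unfold oscIntegral
    linear_combination key
  · have e : HasDerivAt (fun y : ℝ => I * x * (y : ℂ)) (I * x * 1) y :=
      (hasDerivAt_id y).ofReal_comp.const_mul _
    exact (((contDiff_infty_iff_deriv.1 h.1).1 y).hasDerivAt.mul e.cexp).congr_deriv (by ring)

/-- The operator corresponding to `y ∂/∂y` under the Fourier transform. -/
lemma neg_add_mul_deriv {φ : ℝ → ℂ} (h : InvSmooth 2 φ) :
    InvSmooth 2 (fun x => -1 * (φ x + x * _root_.deriv φ x)) :=
  (h.add h.deriv.mul_id).const_mul _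

lemma hasDerivAt_oscIntegral_of_ne {φ : ℝ → ℂ} (h : InvSmooth 2 φ) {x : ℝ} (hx : x ≠ 0) :
    HasDerivAt (oscIntegral volume φ)
      ((x : ℂ)⁻¹ * oscIntegral volume (fun x => -1 * (φ x + x * _root_.deriv φ x)) x) x := by
  have hx' : (x : ℂ) ≠ 0 := ofReal_ne_zero.2 hx
  have h3 := h.deriv
  have hev : oscIntegral volume φ =ᶠ[𝓝 x]
      fun x => I * ((x : ℂ)⁻¹ * oscIntegral volume (_root_.deriv φ) x) := by
    filter_upwards [isOpen_ne.mem_nhds hx] with y hy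
    have : (y : ℂ) ≠ 0 := ofReal_ne_zero.2 hy
    rw [h.oscIntegral_deriv]
    field_simp
    rw [I_sq]; ring
  refine HasDerivAt.congr_of_eventuallyEq ?_ hev
  have d1 : HasDerivAt (fun x : ℝ => (x : ℂ)⁻¹) (-1 / (x : ℂ) ^ 2) x :=
    (hasDerivAt_id x).ofReal_comp.inv hx'
  refine ((d1.mul (hasDerivAt_oscIntegral h3.mono.integrable h3.mul_id.integrable x)).const_mul
    I).congr_deriv ?_
  rw [oscIntegral_const_mul, oscIntegral_const_mul, oscIntegral_add h.integrable h3.mul_id.integrable,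
    h.oscIntegral_deriv]
  field_simp
  linear_combination (oscIntegral volume φ x + oscIntegral volume (fun y => y * _root_.deriv φ y) x) * I_sq

lemma contDiff_oscIntegral {k : ℕ} {φ : ℝ → ℂ} (h : InvSmooth (k + 2) φ) :
    ContDiff ℝ k (oscIntegral volume φ) := by
  induction k generalizing φ with
  | zero => exact contDiff_zero.2 (continuous_oscIntegral h.integrable)
  | succ k ih =>
    have h' : InvSmooth (k + 2) (fun x => (x : ℂ) * φ x) := mul_id h
    have hd := hasDerivAt_oscIntegral (h.of_le (by omega)).integrable
      (h'.of_le (by omega)).integrable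
    push_cast
    rw [contDiff_succ_iff_deriv]
    refine ⟨fun x => (hd x).differentiableAt, by simp, ?_⟩
    rw [show _root_.deriv (oscIntegral volume φ) = _ from funext fun x => (hd x).deriv]
    exact ih (h'.const_mul I)

end InvSmooth

/-- All derivatives of `u` decay faster than any power at `+∞`. -/
def RapidDecay (u : ℝ → ℂ) : Prop :=
  ∀ (k : ℕ) (s : ℝ), iteratedDeriv k u =O[atTop] fun y : ℝ => y ^ s

lemma iteratedDeriv_congr_Ioi {u v : ℝ → ℂ} (h : EqOn u v (Ioi 0)) (k : ℕ) :
    EqOn (iteratedDeriv k u) (iteratedDeriv k v) (Ioi 0) := fun _ hy =>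
  Filter.EventuallyEq.iteratedDeriv_eq k (h.eventuallyEq_of_mem (Ioi_mem_nhds hy))

namespace RapidDecay

lemma congr {u v : ℝ → ℂ} (hu : RapidDecay u) (h : EqOn u v (Ioi 0)) : RapidDecay v :=
  fun k s => (hu k s).congr' ((eventually_gt_atTop 0).mono fun _ hy =>
    iteratedDeriv_congr_Ioi h k hy) EventuallyEq.rfl

lemma deriv {u : ℝ → ℂ} (hu : RapidDecay u) : RapidDecay (deriv u) := fun k s => by
  rw [← iteratedDeriv_succ']
  exact hu (k + 1) s

lemma const_mul {u : ℝ → ℂ} (hu : RapidDecay u) (c : ℂ) : RapidDecay (fun y => c * u y) :=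
  fun k s => by
    have : iteratedDeriv k (fun y => c * u y) = fun y => c * iteratedDeriv k u y :=
      funext fun y => iteratedDeriv_const_mul_field c u
    rw [this]
    exact (hu k s).const_mul_left c

lemma rpow_smul {u : ℝ → ℂ} (hu : RapidDecay u) (hs : ContDiffOn ℝ ∞ u (Ioi 0)) (a : ℝ) :
    RapidDecay (fun y => y ^ a • u y) := fun k s => by
  have h : (fun y : ℝ => ∑ i ∈ Finset.range (k + 1),
      k.choose i • (((descPochhammer ℝ i).eval a * y ^ (a - i)) • iteratedDeriv (k - i) u y))
      =ᶠ[atTop] iteratedDeriv k (fun y => y ^ a • u y) := by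
    filter_upwards [eventually_gt_atTop 0] with y hy
    have h1 : ContDiffWithinAt ℝ k (fun y : ℝ => y ^ a) univ y :=
      (Real.contDiffAt_rpow_const_of_ne hy.ne').contDiffWithinAt
    have h2 : ContDiffWithinAt ℝ k u univ y :=
      ((hs.contDiffAt (Ioi_mem_nhds hy)).of_le (by exact_mod_cast le_top)).contDiffWithinAt
    have := iteratedDerivWithin_smul (mem_univ y) uniqueDiffOn_univ h1 h2
    simp only [iteratedDerivWithin_univ] at this
    rw [show (fun y : ℝ => y ^ a • u y) = (fun y : ℝ => y ^ a) • u from rfl, this]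
    refine Finset.sum_congr rfl fun i _ => ?_
    rw [iteratedDeriv_eq_iterate (f := fun y : ℝ => y ^ a), Real.iter_deriv_rpow_const]
  refine Asymptotics.IsBigO.congr' (Asymptotics.IsBigO.fun_sum fun i _ => ?_) h EventuallyEq.rfl
  simp only [nsmul_eq_mul]
  refine Asymptotics.IsBigO.const_mul_left ?_ _
  have h1 : (fun y : ℝ => (descPochhammer ℝ i).eval a * y ^ (a - i)) =O[atTop]
      fun y : ℝ => y ^ (a - i) := (Asymptotics.isBigO_refl _ _).const_mul_left _
  refine (h1.smul (hu (k - i) (s - (a - i)))).congr' EventuallyEq.rfl ?_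
  filter_upwards [eventually_gt_atTop 0] with y hy
  rw [smul_eq_mul, ← Real.rpow_add hy]
  ring_nf

end RapidDecay

/-- Schwartz functions on the closed half-line `[0, ∞)`. -/
structure HalfSchwartz (h : ℝ → ℂ) : Prop where
  contDiffOn : ContDiffOn ℝ ∞ h (Ici 0)
  decay : RapidDecay h

/-- The Laplace transform on the imaginary axis, `∫_0^∞ h(y) e^(ixy) dy`. -/
noncomputable def halfFourier (h : ℝ → ℂ) : ℝ → ℂ := oscIntegral (volume.restrict (Ioi 0)) h

namespace HalfSchwartz

lemma hasDerivAt {h : ℝ → ℂ} (hh : HalfSchwartz h) {y : ℝ} (hy : 0 < y) :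
    HasDerivAt h (derivWithin h (Ici 0) y) y := by
  have := ((hh.contDiffOn.differentiableOn (by simp)) y hy.le).hasDerivWithinAt
  exact this.hasDerivAt (Ici_mem_nhds hy)

lemma derivWithin {h : ℝ → ℂ} (hh : HalfSchwartz h) : HalfSchwartz (derivWithin h (Ici 0)) :=
  ⟨((contDiffOn_infty_iff_derivWithin (uniqueDiffOn_Ici 0)).1 hh.contDiffOn).2,
    hh.decay.deriv.congr fun _ hy => (hh.hasDerivAt hy).deriv⟩

lemma const_mul {h : ℝ → ℂ} (hh : HalfSchwartz h) (c : ℂ) : HalfSchwartz (fun y => c * h y) :=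
  ⟨contDiffOn_const.mul hh.contDiffOn, hh.decay.const_mul c⟩

lemma mul_id {h : ℝ → ℂ} (hh : HalfSchwartz h) : HalfSchwartz (fun y => (y : ℂ) * h y) :=
  ⟨ofRealCLM.contDiff.contDiffOn.mul hh.contDiffOn,
    (hh.decay.rpow_smul (hh.contDiffOn.mono Ioi_subset_Ici_self) 1).congr fun y _ => by
      simp only [Real.rpow_one, real_smul]⟩

lemma integrable {h : ℝ → ℂ} (hh : HalfSchwartz h) : Integrable h (volume.restrict (Ioi 0)) := by
  have h1 : LocallyIntegrableOn h (Ici 0) :=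
    hh.contDiffOn.continuousOn.locallyIntegrableOn measurableSet_Ici
  have h2 := hh.decay 0 (-2)
  rw [iteratedDeriv_zero] at h2
  have : IntegrableOn h (Ici 0) := h1.integrableOn_of_isBigO_atTop h2
    ⟨Ioi 1, Ioi_mem_atTop 1, integrableOn_Ioi_rpow_of_lt (by norm_num) one_pos⟩
  exact this.mono_set Ioi_subset_Ici_self

lemma tendsto {h : ℝ → ℂ} (hh : HalfSchwartz h) : Tendsto h atTop (𝓝 0) := by
  have h2 := hh.decay 0 (-1)
  rw [iteratedDeriv_zero] at h2
  exact h2.trans_tendsto (tendsto_rpow_neg_atTop one_pos)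

/-- Integration by parts. -/
lemma mul_halfFourier {h : ℝ → ℂ} (hh : HalfSchwartz h) (x : ℝ) :
    (x : ℂ) * halfFourier h x = I * (h 0 + halfFourier (_root_.derivWithin h (Ici 0)) x) := by
  have hi := Integrable.mul_cexp hh.integrable x
  have hi' := Integrable.mul_cexp hh.derivWithin.integrable x
  have key := integral_Ioi_of_hasDerivAt_of_tendsto (a := 0) (m := 0)
    (f := fun y : ℝ => h y * cexp (I * x * y))
    (f' := fun y : ℝ => _root_.derivWithin h (Ici 0) y * cexp (I * x * y) +
      (I * x) * (h y * cexp (I * x * y)))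
    ((hh.contDiffOn.continuousOn 0 self_mem_Ici).mul (by fun_prop)) (fun y hy => ?_)
    (hi'.add (hi.const_mul _)) ?_
  · rw [integral_add hi' (hi.const_mul _), integral_const_mul] at key
    simp only [ofReal_zero, mul_zero, Complex.exp_zero, mul_one, zero_sub] at key
    unfold halfFourier oscIntegral
    linear_combination (-I) * key + ((x : ℂ) * ∫ y in Ioi (0 : ℝ), h y * cexp (I * x * y)) * I_sq
  · have e : HasDerivAt (fun y : ℝ => I * x * (y : ℂ)) (I * x * 1) y :=
      (hasDerivAt_id y).ofReal_comp.const_mul _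
    exact ((hh.hasDerivAt hy).mul e.cexp).congr_deriv (by ring)
  · rw [tendsto_zero_iff_norm_tendsto_zero]
    simp only [norm_mul, norm_cexp_I_mul_mul, mul_one]
    exact tendsto_zero_iff_norm_tendsto_zero.1 hh.tendsto

lemma hasDerivAt_halfFourier {h : ℝ → ℂ} (hh : HalfSchwartz h) (x : ℝ) :
    HasDerivAt (halfFourier h) (I * halfFourier (fun y => (y : ℂ) * h y) x) x := by
  rw [halfFourier, halfFourier, ← oscIntegral_const_mul]
  exact hasDerivAt_oscIntegral hh.integrable hh.mul_id.integrable x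

lemma contDiff_halfFourier {h : ℝ → ℂ} (hh : HalfSchwartz h) : ContDiff ℝ ∞ (halfFourier h) := by
  rw [contDiff_infty]
  intro n
  induction n generalizing h with
  | zero => exact contDiff_zero.2 (continuous_oscIntegral hh.integrable)
  | succ n ih =>
    push_cast
    rw [contDiff_succ_iff_deriv]
    refine ⟨fun x => (hh.hasDerivAt_halfFourier x).differentiableAt, by simp, ?_⟩
    rw [show _root_.deriv (halfFourier h) = _ from
      funext fun x => (hh.hasDerivAt_halfFourier x).deriv]
    exact contDiff_const.mul (ih hh.mul_id)

end HalfSchwartz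

/-- The transform of the function on the line equal to `p(y)` at `y > 0` and to `q(-y)` at
`y < 0`. -/
noncomputable def pairFourier (p q : ℝ → ℂ) (x : ℝ) : ℂ := halfFourier p x + halfFourier q (-x)

/-- The function `ψ` with `pairFourier p q x = x⁻¹ ψ(1/x)`. -/
noncomputable def pairSymbol (p q : ℝ → ℂ) (t : ℝ) : ℂ :=
  if t = 0 then I * (p 0 - q 0) else (t : ℂ)⁻¹ * pairFourier p q t⁻¹

section Pair

variable {p q : ℝ → ℂ}

lemma mul_pairFourier (hp : HalfSchwartz p) (hq : HalfSchwartz q) (x : ℝ) :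
    (x : ℂ) * pairFourier p q x = I * (p 0 - q 0) +
      I * pairFourier (derivWithin p (Ici 0)) (fun y => -1 * derivWithin q (Ici 0) y) x := by
  have h1 := hp.mul_halfFourier x
  have h2 := hq.mul_halfFourier (-x)
  push_cast at h2
  unfold pairFourier
  rw [halfFourier, halfFourier, halfFourier, halfFourier, oscIntegral_const_mul]
  rw [halfFourier, halfFourier] at h1 h2
  linear_combination h1 - h2

lemma hasDerivAt_pairFourier (hp : HalfSchwartz p) (hq : HalfSchwartz q) (x : ℝ) :
    HasDerivAt (pairFourier p q)
      (I * pairFourier (fun y => (y : ℂ) * p y) (fun y => -1 * ((y : ℂ) * q y)) x) x := by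
  have h2 := (hq.hasDerivAt_halfFourier (-x)).scomp x (hasDerivAt_neg x)
  refine ((hp.hasDerivAt_halfFourier x).add h2).congr_deriv ?_
  unfold pairFourier
  simp only [halfFourier, oscIntegral_const_mul]
  simp
  ring

lemma contDiff_pairFourier (hp : HalfSchwartz p) (hq : HalfSchwartz q) :
    ContDiff ℝ ∞ (pairFourier p q) :=
  hp.contDiff_halfFourier.add (hq.contDiff_halfFourier.comp contDiff_neg)

lemma pairSymbol_eq (hp : HalfSchwartz p) (hq : HalfSchwartz q) (t : ℝ) :
    pairSymbol p q t = I * (p 0 - q 0) + I * t *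
      pairSymbol (derivWithin p (Ici 0)) (fun y => -1 * derivWithin q (Ici 0) y) t := by
  unfold pairSymbol
  split_ifs with h
  · simp [h]
  · have := mul_pairFourier hp hq t⁻¹
    push_cast at this
    have ht : (t : ℂ) ≠ 0 := ofReal_ne_zero.2 h
    rw [this]
    field_simp

lemma pairSymbol_of_ne (hp : HalfSchwartz p) (hq : HalfSchwartz q) {t : ℝ} (ht : t ≠ 0) :
    pairSymbol p q t = I * (p 0 - q 0) + I *
      pairFourier (derivWithin p (Ici 0)) (fun y => -1 * derivWithin q (Ici 0) y) t⁻¹ := by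
  have ht' : (t : ℂ) ≠ 0 := ofReal_ne_zero.2 ht
  have := mul_pairFourier hp hq t⁻¹
  push_cast at this
  rw [pairSymbol, if_neg ht, this]

lemma exists_norm_pairSymbol_le (hp : HalfSchwartz p) (hq : HalfSchwartz q) :
    ∃ C, ∀ t, ‖pairSymbol p q t‖ ≤ C := by
  set p' := derivWithin p (Ici 0)
  set q' := fun y => -1 * derivWithin q (Ici 0) y
  refine ⟨‖I * (p 0 - q 0)‖ +
    ((∫ y in Ioi (0 : ℝ), ‖p' y‖) + ∫ y in Ioi (0 : ℝ), ‖q' y‖), fun t => ?_⟩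
  rcases eq_or_ne t 0 with rfl | ht
  · rw [pairSymbol, if_pos rfl]
    exact le_add_of_nonneg_right (by positivity)
  · rw [pairSymbol_of_ne hp hq ht]
    refine (norm_add_le _ _).trans (add_le_add_right ?_ _)
    rw [norm_mul, norm_I, one_mul]
    exact (norm_add_le _ _).trans
      (add_le_add (norm_oscIntegral_le _ _ _) (norm_oscIntegral_le _ _ _))

lemma hasDerivAt_pairSymbol_of_ne (hp : HalfSchwartz p) (hq : HalfSchwartz q) {t : ℝ}
    (ht : t ≠ 0) :
    HasDerivAt (pairSymbol p q)
      (I * pairSymbol (derivWithin (fun y : ℝ => (y : ℂ) * derivWithin p (Ici 0) y) (Ici 0))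
        (fun y => -1 * derivWithin (fun y : ℝ => (y : ℂ) * derivWithin q (Ici 0) y) (Ici 0) y) t) t := by
  have ht' : (t : ℂ) ≠ 0 := ofReal_ne_zero.2 ht
  have hev : pairSymbol p q =ᶠ[𝓝 t] fun t => I * (p 0 - q 0) + I *
      pairFourier (derivWithin p (Ici 0)) (fun y => -1 * derivWithin q (Ici 0) y) t⁻¹ := by
    filter_upwards [isOpen_ne.mem_nhds ht] with s hs using pairSymbol_of_ne hp hq hs
  refine HasDerivAt.congr_of_eventuallyEq ?_ hev
  have hd := (hasDerivAt_pairFourier hp.derivWithin (hq.derivWithin.const_mul (-1)) t⁻¹).scomp t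
    (hasDerivAt_inv ht)
  refine ((hd.const_mul I).const_add _).congr_deriv ?_
  have key := mul_pairFourier hp.derivWithin.mul_id hq.derivWithin.mul_id t⁻¹
  simp only [ofReal_zero, zero_mul, sub_zero, mul_zero, zero_add] at key
  rw [pairSymbol, if_neg ht]
  rw [show (fun y : ℝ => -1 * ((y : ℂ) * (-1 * derivWithin q (Ici 0) y))) =
    fun y : ℝ => (y : ℂ) * derivWithin q (Ici 0) y from funext fun y => by ring, real_smul]
  push_cast at key ⊢
  rw [mul_left_comm I (t : ℂ)⁻¹, ← key]
  field_simp
  rw [I_sq]; ring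

lemma continuous_pairSymbol (hp : HalfSchwartz p) (hq : HalfSchwartz q) :
    Continuous (pairSymbol p q) := by
  refine continuous_iff_continuousAt.2 fun t => ?_
  rcases eq_or_ne t 0 with rfl | ht
  · obtain ⟨C, hC⟩ := exists_norm_pairSymbol_le hp.derivWithin (hq.derivWithin.const_mul (-1))
    rw [funext (pairSymbol_eq hp hq)]
    refine continuousAt_const.add ?_
    rw [ContinuousAt, ofReal_zero, mul_zero, zero_mul]
    refine squeeze_zero_norm (a := fun t : ℝ => |t| * C) (fun t => ?_) ?_
    · rw [norm_mul, norm_mul, norm_I, one_mul, norm_real, Real.norm_eq_abs]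
      gcongr
      exact hC t
    · have : Continuous fun t : ℝ => |t| * C := by fun_prop
      simpa using this.tendsto 0
  · exact (hasDerivAt_pairSymbol_of_ne hp hq ht).continuousAt

lemma contDiff_pairSymbol (hp : HalfSchwartz p) (hq : HalfSchwartz q) :
    ContDiff ℝ ∞ (pairSymbol p q) := by
  rw [contDiff_infty]
  intro n
  induction n generalizing p q with
  | zero => exact contDiff_zero.2 (continuous_pairSymbol hp hq)
  | succ n ih =>
    have hp' := hp.derivWithin.mul_id.derivWithin
    have hq' := hq.derivWithin.mul_id.derivWithin.const_mul (-1)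
    have hd := hasDerivAt_of_hasDerivAt_of_ne' (x := 0) (f := pairSymbol p q)
      (g := fun t => I * pairSymbol _ _ t) (fun t ht => hasDerivAt_pairSymbol_of_ne hp hq ht)
      (continuous_pairSymbol hp hq).continuousAt
      (continuous_const.mul (continuous_pairSymbol hp' hq')).continuousAt
    push_cast
    rw [contDiff_succ_iff_deriv]
    refine ⟨fun x => (hd x).differentiableAt, by simp, ?_⟩
    rw [show deriv (pairSymbol p q) = _ from funext fun x => (hd x).deriv]
    exact contDiff_const.mul (ih hp' hq')

/-- If `p` and `q` are the two halves of a `C^n` function, then the first `n + 1` boundary terms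
vanish. -/
lemma exists_pow_mul_pairFourier (n : ℕ) {g : ℝ → ℂ} (hg : ContDiff ℝ n g)
    (hp : HalfSchwartz p) (hq : HalfSchwartz q) (hpg : EqOn p g (Ici 0))
    (hqg : EqOn q (fun y => g (-y)) (Ici 0)) :
    ∃ p' q', HalfSchwartz p' ∧ HalfSchwartz q' ∧
      ∀ x : ℝ, (x : ℂ) ^ (n + 1) * pairFourier p q x = I ^ (n + 1) * pairFourier p' q' x := by
  have h0 : p 0 - q 0 = 0 := by
    simp [hpg self_mem_Ici, hqg self_mem_Ici]
  have key : ∀ x : ℝ, (x : ℂ) * pairFourier p q x = I * pairFourier (derivWithin p (Ici 0))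
      (fun y => -1 * derivWithin q (Ici 0) y) x := fun x => by
    rw [mul_pairFourier hp hq, h0, mul_zero, zero_add]
  induction n generalizing p q g with
  | zero =>
    exact ⟨_, _, hp.derivWithin, hq.derivWithin.const_mul (-1), fun x => by simpa using key x⟩
  | succ n ih =>
    push_cast at hg
    rw [contDiff_succ_iff_deriv] at hg
    have e1 : EqOn (derivWithin p (Ici 0)) (deriv g) (Ici 0) := fun y hy => by
      rw [derivWithin_congr hpg (hpg hy)]
      exact (hg.1 y).derivWithin (uniqueDiffOn_Ici 0 y hy)
    have e2 : EqOn (fun y => -1 * derivWithin q (Ici 0) y) (fun y => deriv g (-y)) (Ici 0) :=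
      fun y hy => by
        have : HasDerivAt (fun y => g (-y)) (-deriv g (-y)) y := 
          ((hg.1 (-y)).hasDerivAt.scomp y (hasDerivAt_neg y)).congr_deriv (by simp)
        simp only
        rw [derivWithin_congr hqg (hqg hy), this.hasDerivWithinAt.derivWithin
          (uniqueDiffOn_Ici 0 y hy)]
        ring
    have hp' := hp.derivWithin
    have hq' := hq.derivWithin.const_mul (-1)
    have h0' : derivWithin p (Ici 0) 0 - (fun y => -1 * derivWithin q (Ici 0) y) 0 = 0 := by
      rw [e1 self_mem_Ici, e2 self_mem_Ici]; simp
    obtain ⟨P, Q, hP, hQ, h⟩ := ih hg.2.2 hp' hq' e1 e2 h0' fun x => by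
      rw [mul_pairFourier hp' hq', h0', mul_zero, zero_add]
    refine ⟨P, Q, hP, hQ, fun x => ?_⟩
    rw [pow_succ, mul_assoc, key, mul_left_comm, h, pow_succ I (n + 1)]
    ring

lemma invSmooth_pairFourier {n : ℕ} {g : ℝ → ℂ} (hg : ContDiff ℝ n g)
    (hp : HalfSchwartz p) (hq : HalfSchwartz q) (hpg : EqOn p g (Ici 0))
    (hqg : EqOn q (fun y => g (-y)) (Ici 0)) : InvSmooth (n + 2) (pairFourier p q) := by
  obtain ⟨P, Q, hP, hQ, h⟩ := exists_pow_mul_pairFourier n hg hp hq hpg hqg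
  refine ⟨contDiff_pairFourier hp hq, fun t => I ^ (n + 1) * pairSymbol P Q t,
    contDiff_const.mul (contDiff_pairSymbol hP hQ), fun x hx => ?_⟩
  have hx' : (x : ℂ) ≠ 0 := ofReal_ne_zero.2 hx
  have := h x
  simp only [pairSymbol, if_neg (inv_ne_zero hx), inv_inv, ofReal_inv]
  rw [eq_inv_mul_iff_mul_eq₀ (pow_ne_zero _ hx')]
  linear_combination (x : ℂ) * this

end Pair

lemma oscIntegral_oscIntegral_neg {g : ℝ → ℂ} (hc : Continuous g) (hi : Integrable g)
    (hφ : Integrable (oscIntegral volume g)) (y : ℝ) :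
    oscIntegral volume (oscIntegral volume g) (-y) = 2 * Real.pi * g y := by
  have hpi : (2 * Real.pi : ℝ) ≠ 0 := by positivity
  have e1 : ∀ u : ℝ → ℂ, 𝓕 u = fun w => oscIntegral volume u (-(2 * Real.pi) * w) := fun u => by
    ext w
    rw [Real.fourier_eq', oscIntegral]
    refine integral_congr_ae (ae_of_all _ fun v => ?_)
    simp only [smul_eq_mul, RCLike.inner_apply, conj_trivial]
    rw [mul_comm]
    congr 2
    push_cast
    ring
  have e2 : 𝓕⁻ g = fun w => oscIntegral volume g (2 * Real.pi * w) := by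
    ext w
    rw [Real.fourierInv_eq', oscIntegral]
    refine integral_congr_ae (ae_of_all _ fun v => ?_)
    simp only [smul_eq_mul, RCLike.inner_apply, conj_trivial]
    rw [mul_comm]
    congr 2
    push_cast
    ring
  have h := congrFun (hc.fourier_fourierInv_eq hi (by
    rw [e1]; exact hφ.comp_mul_left' (neg_ne_zero.2 hpi))) y
  rw [e1, e2] at h
  rw [← h]
  have := Measure.integral_comp_mul_left
    (fun u : ℝ => oscIntegral volume g u * cexp (I * ((-y : ℝ) : ℂ) * u)) (2 * Real.pi)
  simp only [oscIntegral] at this ⊢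
  rw [abs_of_pos (by positivity), real_smul] at this
  have h2 : (∫ (y_1 : ℝ), (∫ (y : ℝ), g y * cexp (I * ((2 * Real.pi * y_1 : ℝ) : ℂ) * y)) *
      cexp (I * ((-(2 * Real.pi) * y : ℝ) : ℂ) * y_1)) =
    ∫ (x : ℝ), (∫ (y : ℝ), g y * cexp (I * ((2 * Real.pi * x : ℝ) : ℂ) * y)) *
      cexp (I * ((-y : ℝ) : ℂ) * ((2 * Real.pi * x : ℝ) : ℂ)) := by
    refine integral_congr_ae (ae_of_all _ fun v => ?_)
    simp only
    congr 2
    push_cast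
    ring
  rw [h2, this]
  push_cast
  have : (Real.pi : ℂ) ≠ 0 := ofReal_ne_zero.2 Real.pi_ne_zero
  field_simp
  refine integral_congr_ae (ae_of_all _ fun u => ?_)
  simp only
  congr 3
  ring

/-- The function `y^k e^(-y)`. -/
noncomputable def gammaDensity (k : ℕ) (y : ℝ) : ℂ := (y : ℂ) ^ k * cexp (-y)

lemma contDiff_gammaDensity (k : ℕ) : ContDiff ℝ ∞ (gammaDensity k) :=
  (ofRealCLM.contDiff.pow k).mul ofRealCLM.contDiff.neg.cexp

lemma hasDerivAt_cexp_neg (y : ℝ) : HasDerivAt (fun y : ℝ => cexp (-y)) (-1 * cexp (-y)) y :=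
  (hasDerivAt_id y).ofReal_comp.neg.cexp.congr_deriv (by simp)

lemma halfSchwartz_gammaDensity (k : ℕ) : HalfSchwartz (gammaDensity k) := by
  induction k with
  | zero =>
    refine ⟨(contDiff_gammaDensity 0).contDiffOn, fun k s => ?_⟩
    have h0 : gammaDensity 0 = fun y : ℝ => cexp (-y) := by ext; simp [gammaDensity]
    have hk : iteratedDeriv k (gammaDensity 0) = fun y : ℝ => (-1) ^ k * cexp (-y) := by
      induction k with
      | zero => simp [h0]
      | succ k ih =>
        rw [iteratedDeriv_succ, ih]
        ext y
        rw [((hasDerivAt_cexp_neg y).const_mul _).deriv]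
        ring
    rw [hk]
    refine Asymptotics.IsBigO.const_mul_left ?_ _
    refine Asymptotics.IsBigO.trans (Asymptotics.IsBigO.of_norm_left ?_)
      (isLittleO_exp_neg_mul_rpow_atTop one_pos s).isBigO
    refine (Asymptotics.isBigO_refl _ _).congr_left fun y => ?_
    rw [← ofReal_neg, norm_exp_ofReal, neg_one_mul]
  | succ k ih =>
    convert ih.mul_id using 1
    ext y
    simp only [gammaDensity]
    ring

lemma derivWithin_gammaDensity_zero {y : ℝ} (hy : y ∈ Ici (0 : ℝ)) :
    derivWithin (gammaDensity 0) (Ici 0) y = -1 * gammaDensity 0 y := by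
  have h0 : gammaDensity 0 = fun y : ℝ => cexp (-y) := by ext; simp [gammaDensity]
  rw [h0]
  exact (hasDerivAt_cexp_neg y).hasDerivWithinAt.derivWithin (uniqueDiffOn_Ici 0 y hy)

lemma derivWithin_gammaDensity_succ (k : ℕ) {y : ℝ} (hy : y ∈ Ici (0 : ℝ)) :
    derivWithin (gammaDensity (k + 1)) (Ici 0) y =
      (k + 1) * gammaDensity k y + -1 * gammaDensity (k + 1) y := by
  have h := (((hasDerivAt_id y).ofReal_comp.pow (k + 1)).mul (hasDerivAt_cexp_neg y))
  refine (h.hasDerivWithinAt.derivWithin (uniqueDiffOn_Ici 0 y hy)).trans ?_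
  simp [gammaDensity]
  ring

lemma halfFourier_congr {g h : ℝ → ℂ} (hgh : EqOn g h (Ici 0)) (x : ℝ) :
    halfFourier g x = halfFourier h x :=
  setIntegral_congr_fun measurableSet_Ioi fun y hy => by
    simp only [hgh (Ioi_subset_Ici_self hy)]

lemma one_sub_I_mul_ne_zero (x : ℝ) : (1 - I * x : ℂ) ≠ 0 := fun h => by
  simpa using congrArg re h

lemma halfFourier_gammaDensity (k : ℕ) (x : ℝ) :
    halfFourier (gammaDensity k) x = k.factorial * ((1 - I * x : ℂ) ^ (k + 1))⁻¹ := by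
  have hx := one_sub_I_mul_ne_zero x
  induction k with
  | zero =>
    have h := (halfSchwartz_gammaDensity 0).mul_halfFourier x
    rw [halfFourier_congr (h := fun y => -1 * gammaDensity 0 y)
      (fun y hy => derivWithin_gammaDensity_zero hy)] at h
    simp only [halfFourier, oscIntegral_const_mul] at h ⊢
    rw [show gammaDensity 0 0 = 1 by simp [gammaDensity]] at h
    have key : (1 - I * x) * oscIntegral (volume.restrict (Ioi 0)) (gammaDensity 0) x = 1 := by
      linear_combination (-I) * h -
        (1 - oscIntegral (volume.restrict (Ioi 0)) (gammaDensity 0) x) * I_sq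
    rw [← mul_right_inj' hx, key]
    simp [hx]
  | succ k ih =>
    have h := (halfSchwartz_gammaDensity (k + 1)).mul_halfFourier x
    rw [halfFourier_congr (h := fun y => (k + 1) * gammaDensity k y + -1 * gammaDensity (k + 1) y)
      (fun y hy => derivWithin_gammaDensity_succ k hy)] at h
    have e := oscIntegral_add ((halfSchwartz_gammaDensity k).const_mul (k + 1)).integrable
      ((halfSchwartz_gammaDensity (k + 1)).const_mul (-1)).integrable x
    rw [oscIntegral_const_mul, oscIntegral_const_mul] at e
    simp only [halfFourier] at h ih ⊢
    rw [e, ih, show gammaDensity (k + 1) 0 = 0 by simp [gammaDensity]] at h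
    rw [Nat.factorial_succ]
    push_cast
    have key : (1 - I * x) * oscIntegral (volume.restrict (Ioi 0)) (gammaDensity (k + 1)) x =
      (k + 1) * (k.factorial * ((1 - I * x : ℂ) ^ (k + 1))⁻¹) := by
      linear_combination (-I) * h - ((k + 1) * (k.factorial * ((1 - I * x : ℂ) ^ (k + 1))⁻¹) -
        oscIntegral (volume.restrict (Ioi 0)) (gammaDensity (k + 1)) x) * I_sq
    rw [← mul_right_inj' hx, key]
    field_simp
    ring

lemma ofReal_sub_I_ne_zero (t : ℝ) : (t - I : ℂ) ≠ 0 := fun h => by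
  simpa using congrArg im h

lemma contDiff_modelSymbol (k : ℕ) :
    ContDiff ℝ ∞ (fun t : ℝ => (k.factorial : ℂ) * ((t - I : ℂ) ^ (k + 1))⁻¹) :=
  contDiff_const.mul (((ofRealCLM.contDiff.sub contDiff_const).pow _).inv
    fun t => pow_ne_zero _ (ofReal_sub_I_ne_zero t))

lemma halfFourier_gammaDensity_eq (k : ℕ) {x : ℝ} (hx : x ≠ 0) :
    halfFourier (gammaDensity k) x =
      ((x : ℂ) ^ (k + 1))⁻¹ * (k.factorial * (((x⁻¹ : ℝ) - I : ℂ) ^ (k + 1))⁻¹) := by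
  have hx' : (x : ℂ) ≠ 0 := ofReal_ne_zero.2 hx
  rw [halfFourier_gammaDensity, show (1 - I * x : ℂ) = x * ((x⁻¹ : ℝ) - I) by
    push_cast; field_simp, mul_pow, mul_inv]
  ring

lemma invSmooth_halfFourier_gammaDensity (k : ℕ) :
    InvSmooth (k + 1) (halfFourier (gammaDensity k)) :=
  ⟨(halfSchwartz_gammaDensity k).contDiff_halfFourier, _, contDiff_modelSymbol k,
    fun _ hx => halfFourier_gammaDensity_eq k hx⟩

lemma halfFourier_eq_oscIntegral_indicator (h : ℝ → ℂ) :
    halfFourier h = oscIntegral volume ((Ioi 0).indicator h) := by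
  ext x
  rw [halfFourier, oscIntegral, oscIntegral, ← integral_indicator measurableSet_Ioi]
  refine integral_congr_ae (ae_of_all _ fun y => ?_)
  by_cases hy : y ∈ Ioi (0 : ℝ) <;> simp [hy]

lemma oscIntegral_halfFourier_gammaDensity (k : ℕ) (y : ℝ) :
    oscIntegral volume (halfFourier (gammaDensity (k + 1))) (-y) =
      2 * Real.pi * (Ioi 0).indicator (gammaDensity (k + 1)) y := by
  rw [halfFourier_eq_oscIntegral_indicator]
  refine oscIntegral_oscIntegral_neg ?_ ?_ ?_ y
  · have : (Ioi 0).indicator (gammaDensity (k + 1)) =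
        fun y : ℝ => ((max y 0 : ℝ) : ℂ) ^ (k + 1) * cexp (-y) := by
      ext y
      by_cases hy : 0 < y
      · rw [indicator_of_mem (mem_Ioi.2 hy), max_eq_left hy.le, gammaDensity]
      · rw [indicator_of_notMem (by simpa using hy), max_eq_right (not_lt.1 hy)]
        simp
    rw [this]
    fun_prop
  · rw [integrable_indicator_iff measurableSet_Ioi]
    exact (halfSchwartz_gammaDensity _).integrable
  · rw [← halfFourier_eq_oscIntegral_indicator]
    exact ((invSmooth_halfFourier_gammaDensity (k + 1)).of_le (by omega)).integrable

lemma contDiff_integral_pow_smul_comp_mul {ψ : ℝ → ℂ} (hψ : ContDiff ℝ ∞ ψ) (m : ℕ) :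
    ContDiff ℝ ∞ (fun t : ℝ => ∫ s in (0 : ℝ)..1, s ^ m • ψ (s * t)) := by
  rw [contDiff_infty]
  intro n
  induction n generalizing m ψ with
  | zero =>
    have := hψ.continuous
    exact contDiff_zero.2 (intervalIntegral.continuous_parametric_intervalIntegral_of_continuous'
      (by fun_prop) 0 1)
  | succ n ih =>
    have hψ' := contDiff_infty_iff_deriv.1 hψ
    have c1 := hψ.continuous
    have c2 := hψ'.2.continuous
    have hd : ∀ t : ℝ, HasDerivAt (fun t : ℝ => ∫ s in (0 : ℝ)..1, s ^ m • ψ (s * t))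
        (∫ s in (0 : ℝ)..1, s ^ (m + 1) • deriv ψ (s * t)) t := fun t => by
      obtain ⟨C, hC⟩ := ((isCompact_Icc (a := (0 : ℝ)) (b := 1)).prod
        (isCompact_closedBall t 1)).exists_bound_of_continuousOn
        (f := fun z : ℝ × ℝ => z.1 ^ (m + 1) • deriv ψ (z.1 * z.2)) (by fun_prop)
      refine (intervalIntegral.hasDerivAt_integral_of_dominated_loc_of_deriv_le
        (F := fun t s => s ^ m • ψ (s * t)) (F' := fun t s => s ^ (m + 1) • deriv ψ (s * t))
        (bound := fun _ => C) (Metric.closedBall_mem_nhds t one_pos)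
        (Eventually.of_forall fun t => (by fun_prop : Continuous fun s : ℝ =>
          s ^ m • ψ (s * t)).aestronglyMeasurable)
        ((by fun_prop : Continuous fun s : ℝ => s ^ m • ψ (s * t)).intervalIntegrable _ _)
        (by fun_prop : Continuous fun s : ℝ => s ^ (m + 1) • deriv ψ (s * t)).aestronglyMeasurable
        (ae_of_all _ fun s hs x hx => hC (s, x) ⟨?_, hx⟩) (by simp)
        (ae_of_all _ fun s hs x hx => ?_)).2
      · rw [uIoc_of_le zero_le_one] at hs
        exact ⟨hs.1.le, hs.2⟩
      · have h1 : HasDerivAt (fun x : ℝ => s * x) s x := by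
          simpa using (hasDerivAt_id x).const_mul s
        refine (((hψ'.1 (s * x)).hasDerivAt.scomp x h1).const_smul (s ^ m)).congr_deriv ?_
        rw [smul_smul, pow_succ]
    push_cast
    rw [contDiff_succ_iff_deriv]
    refine ⟨fun x => (hd x).differentiableAt, by simp, ?_⟩
    rw [show deriv (fun t : ℝ => ∫ s in (0 : ℝ)..1, s ^ m • ψ (s * t)) = _ from
      funext fun x => (hd x).deriv]
    exact ih hψ'.2 (m + 1)

/-- Hadamard's lemma in one variable. -/
lemma exists_contDiff_eq_add_mul {ψ : ℝ → ℂ} (hψ : ContDiff ℝ ∞ ψ) :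
    ∃ χ : ℝ → ℂ, ContDiff ℝ ∞ χ ∧ ∀ t, ψ t = ψ 0 + t * χ t := by
  have hψ' := contDiff_infty_iff_deriv.1 hψ
  have c2 := hψ'.2.continuous
  refine ⟨_, contDiff_integral_pow_smul_comp_mul hψ'.2 0, fun t => ?_⟩
  have h := intervalIntegral.integral_eq_sub_of_hasDerivAt (a := 0) (b := 1)
    (f := fun s : ℝ => ψ (s * t)) (f' := fun s : ℝ => t • deriv ψ (s * t)) (fun s _ => by
      have h1 : HasDerivAt (fun s : ℝ => s * t) t s := by
        simpa using (hasDerivAt_id s).mul_const t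
      exact (hψ'.1 (s * t)).hasDerivAt.scomp s h1)
    ((by fun_prop : Continuous fun s : ℝ => t • deriv ψ (s * t)).intervalIntegrable _ _)
  rw [intervalIntegral.integral_smul, real_smul] at h
  simp only [one_mul, zero_mul, pow_zero, one_smul] at h ⊢
  linear_combination -h

namespace InvSmooth

lemma exists_sub_model {k : ℕ} {φ : ℝ → ℂ} (h : InvSmooth (k + 1) φ) :
    ∃ b : ℂ, InvSmooth (k + 2) (fun x => φ x + b * halfFourier (gammaDensity k) x) := by
  obtain ⟨h1, ψ, hψ, h⟩ := h
  set ε : ℝ → ℂ := fun t : ℝ => (k.factorial : ℂ) * ((t - I : ℂ) ^ (k + 1))⁻¹ with hε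
  have hε0 : ε 0 ≠ 0 := mul_ne_zero (by exact_mod_cast k.factorial_ne_zero)
    (inv_ne_zero (pow_ne_zero _ (ofReal_sub_I_ne_zero 0)))
  set b := -(ψ 0 / ε 0)
  obtain ⟨χ, hχ, e⟩ := exists_contDiff_eq_add_mul
    (hψ.add (contDiff_const (c := b) |>.mul (contDiff_modelSymbol k)))
  refine ⟨b, h1.add (contDiff_const.mul (halfSchwartz_gammaDensity k).contDiff_halfFourier), χ, hχ,
    fun x hx => ?_⟩
  have hx' : (x : ℂ) ≠ 0 := ofReal_ne_zero.2 hx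
  have e' : ψ x⁻¹ + b * ε x⁻¹ = ψ 0 + b * ε 0 + (x⁻¹ : ℝ) * χ x⁻¹ := e x⁻¹
  have e0 : ψ 0 + b * ε 0 = 0 := by simp only [b]; field_simp; ring
  rw [e0, zero_add] at e'
  have e3 : halfFourier (gammaDensity k) x = ((x : ℂ) ^ (k + 1))⁻¹ * ε x⁻¹ :=
    halfFourier_gammaDensity_eq k hx
  simp only [h x hx, e3]
  have : χ x⁻¹ = x * (ψ x⁻¹ + b * ε x⁻¹) := by
    rw [e']; push_cast; field_simp
  rw [this]
  field_simp
  ring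

lemma contDiffOn_oscIntegral (m : ℕ) {k : ℕ} {φ : ℝ → ℂ} (h : InvSmooth (k + 2) φ) :
    ContDiffOn ℝ (k + m : ℕ) (fun y => oscIntegral volume φ (-y)) (Ici 0) ∧
    ContDiffOn ℝ (k + m : ℕ) (fun y => oscIntegral volume φ (-y)) (Iic 0) := by
  induction m generalizing k φ with
  | zero =>
    have := h.contDiff_oscIntegral.comp (contDiff_neg (𝕜 := ℝ))
    exact ⟨this.contDiffOn, this.contDiffOn⟩
  | succ m ih =>
    obtain ⟨b, hb⟩ := h.exists_sub_model
    have h2 := invSmooth_halfFourier_gammaDensity (k + 1)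
    have e : ∀ y : ℝ, oscIntegral volume φ (-y) =
        oscIntegral volume (fun x => φ x + b * halfFourier (gammaDensity (k + 1)) x) (-y) -
          b * (2 * Real.pi * (Ioi 0).indicator (gammaDensity (k + 1)) y) := fun y => by
      rw [oscIntegral_add (h.of_le (by omega)).integrable
        ((h2.of_le (by omega)).const_mul b).integrable, oscIntegral_const_mul,
        oscIntegral_halfFourier_gammaDensity]
      ring
    obtain ⟨i1, i2⟩ := ih hb
    rw [show k + 1 + m = k + (m + 1) by ring] at i1 i2
    constructor
    · refine (i1.sub (contDiffOn_const (c := b) |>.mul (contDiffOn_const (c := (2 * Real.pi : ℂ)) |>.mul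
        ((contDiff_gammaDensity (k + 1)).of_le
          (by exact_mod_cast le_top)).contDiffOn))).congr fun y hy => ?_
      rw [e]
      rcases eq_or_lt_of_le (mem_Ici.1 hy) with rfl | hy
      · simp [gammaDensity]
      · rw [indicator_of_mem (mem_Ioi.2 hy)]
    · refine i2.congr fun y hy => ?_
      rw [e, indicator_of_notMem (by simpa using hy)]
      simp

end InvSmooth

/-- The function `|y|^s y^(-a) φ̂(y)`. -/
noncomputable def weightedFourier (s : ℝ) (a : ℕ) (φ : ℝ → ℂ) (y : ℝ) : ℂ :=
  ((|y| ^ s : ℝ) : ℂ) * (((y : ℂ) ^ a)⁻¹ * oscIntegral volume φ (-y))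

lemma hasDerivAt_abs_rpow_of_ne (s : ℝ) {y : ℝ} (hy : y ≠ 0) :
    HasDerivAt (fun y : ℝ => |y| ^ s) (|y| ^ s * (s * y⁻¹)) y := by
  have h : ∀ z : ℝ, z ≠ 0 → |z| ^ s = Real.exp (Real.log z * s) := fun z hz => by
    rw [Real.rpow_def_of_pos (abs_pos.2 hz), Real.log_abs]
  have hev : (fun y : ℝ => |y| ^ s) =ᶠ[𝓝 y] fun y => Real.exp (Real.log y * s) := by
    filter_upwards [isOpen_ne.mem_nhds hy] with z hz using h z hz
  refine HasDerivAt.congr_of_eventuallyEq ?_ hev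
  refine ((Real.hasDerivAt_log hy).mul_const s).exp.congr_deriv ?_
  rw [h y hy]
  ring

namespace InvSmooth

variable {φ : ℝ → ℂ}

lemma exists_hasDerivAt_weightedFourier (h : InvSmooth 2 φ) (s : ℝ) (a : ℕ) :
    ∃ χ, InvSmooth 2 χ ∧ ∀ y : ℝ, y ≠ 0 →
      HasDerivAt (weightedFourier s a φ) (weightedFourier s (a + 1) χ y) y := by
  have h' := h.neg_add_mul_deriv
  refine ⟨_, h'.add (h.const_mul (s - a)), fun y hy => ?_⟩
  have hy' : (y : ℂ) ≠ 0 := ofReal_ne_zero.2 hy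
  have d1 := (hasDerivAt_abs_rpow_of_ne s hy).ofReal_comp
  have d2 : HasDerivAt (fun y : ℝ => ((y : ℂ) ^ a)⁻¹)
      (-(a * (y : ℂ) ^ (a - 1) * 1) / ((y : ℂ) ^ a) ^ 2) y :=
    ((hasDerivAt_id y).ofReal_comp.pow a).inv (pow_ne_zero _ hy')
  have d3 := (h.hasDerivAt_oscIntegral_of_ne (neg_ne_zero.2 hy)).scomp y (hasDerivAt_neg y)
  refine (d1.mul (d2.mul d3)).congr_deriv ?_
  rw [weightedFourier, oscIntegral_add h'.integrable (h.const_mul _).integrable,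
    oscIntegral_const_mul _ (s - a : ℂ)]
  simp only [Pi.mul_apply, Function.comp, real_smul]
  push_cast
  rcases a with _ | a
  · simp
    field_simp
    ring
  · simp only [Nat.add_sub_cancel]
    push_cast
    field_simp
    ring

lemma contDiffOn_weightedFourier (h : InvSmooth 2 φ) (s : ℝ) (a : ℕ) :
    ContDiffOn ℝ ∞ (weightedFourier s a φ) {0}ᶜ := by
  rw [contDiffOn_infty]
  intro n
  induction n generalizing φ a with
  | zero =>
    obtain ⟨χ, -, hd⟩ := h.exists_hasDerivAt_weightedFourier s a
    exact contDiffOn_zero.2 fun y hy => (hd y hy).continuousAt.continuousWithinAt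
  | succ n ih =>
    obtain ⟨χ, hχ, hd⟩ := h.exists_hasDerivAt_weightedFourier s a
    push_cast
    rw [contDiffOn_succ_iff_deriv_of_isOpen isOpen_compl_singleton]
    exact ⟨fun y hy => (hd y hy).differentiableAt.differentiableWithinAt, by simp,
      (ih hχ (a + 1)).congr fun y hy => (hd y hy).deriv⟩

lemma exists_iteratedDeriv_eq_weightedFourier (h : InvSmooth 2 φ) (s : ℝ) {u : ℝ → ℂ}
    (hu : EqOn u (weightedFourier s 0 φ) {0}ᶜ) (k : ℕ) :
    ∃ χ, InvSmooth 2 χ ∧ EqOn (iteratedDeriv k u) (weightedFourier s k χ) {0}ᶜ := by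
  induction k with
  | zero => exact ⟨φ, h, by simpa using hu⟩
  | succ k ih =>
    obtain ⟨χ, hχ, e⟩ := ih
    obtain ⟨χ', hχ', hd⟩ := hχ.exists_hasDerivAt_weightedFourier s k
    refine ⟨χ', hχ', fun y hy => ?_⟩
    rw [iteratedDeriv_succ, (e.eventuallyEq_of_mem (isOpen_compl_singleton.mem_nhds hy)).deriv_eq]
    exact (hd y hy).deriv

lemma exists_pow_mul_norm_oscIntegral_le (h : InvSmooth 2 φ) (m : ℕ) :
    ∃ C, ∀ y : ℝ, |y| ^ m * ‖oscIntegral volume φ y‖ ≤ C := by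
  induction m generalizing φ with
  | zero => exact ⟨_, fun y => by simpa using norm_oscIntegral_le volume φ y⟩
  | succ m ih =>
    obtain ⟨C, hC⟩ := ih h.deriv.mono
    refine ⟨C, fun y => ?_⟩
    have := hC y
    rw [h.oscIntegral_deriv, norm_mul, norm_mul, norm_neg, norm_I, norm_real, Real.norm_eq_abs] at this
    rw [pow_succ, mul_assoc]
    simpa using this

lemma exists_pow_mul_norm_weightedFourier_le (h : InvSmooth 2 φ) (s : ℝ) (a n : ℕ) :
    ∃ C, ∀ y : ℝ, 1 ≤ |y| → |y| ^ n * ‖weightedFourier s a φ y‖ ≤ C := by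
  obtain ⟨C, hC⟩ := h.exists_pow_mul_norm_oscIntegral_le (n + ⌈s⌉₊)
  refine ⟨C, fun y hy => le_trans ?_ (hC (-y))⟩
  have hy0 : (0 : ℝ) < |y| := by linarith
  rw [weightedFourier, norm_mul, norm_mul, norm_inv, norm_pow, norm_real, norm_real, Real.norm_eq_abs,
    Real.norm_eq_abs, abs_of_nonneg (Real.rpow_nonneg hy0.le s), abs_neg, pow_add, mul_assoc]
  have h1 : |y| ^ s ≤ |y| ^ ⌈s⌉₊ := by
    rw [← Real.rpow_natCast]
    exact Real.rpow_le_rpow_of_exponent_le hy (Nat.le_ceil s)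
  have h2 : (|y| ^ a)⁻¹ ≤ 1 := inv_le_one_of_one_le₀ (one_le_pow₀ hy)
  gcongr
  calc (|y| ^ a)⁻¹ * ‖oscIntegral volume φ (-y)‖ ≤ 1 * ‖oscIntegral volume φ (-y)‖ := by gcongr
    _ = _ := one_mul _

end InvSmooth

lemma extendByZero_of_ne (f : PuncturedLine → ℂ) {y : ℝ} (hy : y ≠ 0) :
    extendByZero f y = f ⟨y, hy⟩ := dif_pos hy

theorem kirillovMap_mem {e : ℕ} {φ : ℝ → ℂ} (h : InvSmooth (e + 2) φ) :
    SmoothOffZero (kirillovMap (e + 1) φ) ∧ RapidlyDecreasing (kirillovMap (e + 1) φ) ∧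
      RegularAtZero (e + 1) (kirillovMap (e + 1) φ) := by
  set c : ℂ := (((2 * Real.pi) ^ (-(1 / 2) : ℝ) : ℝ) : ℂ) with hc
  set s : ℝ := (1 - ((e + 1 : ℕ) : ℝ)) / 2 with hs
  have h2 : InvSmooth 2 (fun x => c * φ x) := (h.of_le (by omega)).const_mul c
  have hF : ∀ y, unitaryFourier φ y = oscIntegral volume (fun x => c * φ x) (-y) := fun y => by
    rw [unitaryFourier_eq, oscIntegral_const_mul]
  have hu : EqOn (extendByZero (kirillovMap (e + 1) φ))
      (weightedFourier s 0 (fun x => c * φ x)) {0}ᶜ := fun y hy => by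
    rw [extendByZero_of_ne _ hy, kirillovMap, weightedFourier, hF, pow_zero, inv_one, one_mul]
  refine ⟨(h2.contDiffOn_weightedFourier s 0).congr hu, fun k n => ?_, unitaryFourier φ,
    fun y => ?_, ?_, ?_, ?_⟩
  · obtain ⟨χ, hχ, e⟩ := h2.exists_iteratedDeriv_eq_weightedFourier s hu k
    obtain ⟨C, hC⟩ := hχ.exists_pow_mul_norm_weightedFourier_le s k n
    refine ⟨C, 1, fun y hy => ?_⟩
    have hy0 : y ≠ 0 := by rintro rfl; norm_num at hy
    rw [e hy0]
    exact hC y hy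
  · rw [kirillovMap, ← mul_assoc, ← ofReal_mul, ← Real.rpow_add (abs_pos.2 y.2)]
    rw [show (((e + 1 : ℕ) : ℝ) - 1) / 2 + (1 - ((e + 1 : ℕ) : ℝ)) / 2 = 0 by ring, Real.rpow_zero]
    simp
  · refine contDiffOn_infty.2 fun n => ?_
    rw [funext hF]
    exact (((h.const_mul c).contDiffOn_oscIntegral n).1).of_le (by exact_mod_cast Nat.le_add_left n e)
  · refine contDiffOn_infty.2 fun n => ?_
    rw [funext hF]
    exact (((h.const_mul c).contDiffOn_oscIntegral n).2).of_le (by exact_mod_cast Nat.le_add_left n e)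
  · rw [funext hF]
    exact ((h.const_mul c).contDiff_oscIntegral.comp contDiff_neg).contDiffAt

lemma rapidDecay_of_bound {u : ℝ → ℂ} (h : ∀ k n : ℕ, ∃ C R : ℝ, ∀ y : ℝ, R ≤ y →
    |y| ^ n * ‖iteratedDeriv k u y‖ ≤ C) : RapidDecay u := fun k s => by
  obtain ⟨C, R, hC⟩ := h k ⌈-s⌉₊
  refine Asymptotics.IsBigO.of_bound C ?_
  filter_upwards [eventually_ge_atTop R, eventually_ge_atTop 1] with y hR h1
  have hy : 0 < y := by linarith
  have := hC y hR
  rw [abs_of_pos hy] at this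
  rw [Real.norm_of_nonneg (Real.rpow_nonneg hy.le s)]
  have h2 : y ^ (-s) ≤ y ^ ⌈-s⌉₊ := by
    rw [← Real.rpow_natCast]
    exact Real.rpow_le_rpow_of_exponent_le h1 (Nat.le_ceil _)
  have h3 : y ^ (-s) * ‖iteratedDeriv k u y‖ ≤ C :=
    (mul_le_mul_of_nonneg_right h2 (norm_nonneg _)).trans this
  rw [Real.rpow_neg hy.le, inv_mul_le_iff₀ (Real.rpow_pos_of_pos hy s)] at h3
  linarith

lemma integrable_of_halfSchwartz {g : ℝ → ℂ} (hp : HalfSchwartz g)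
    (hq : HalfSchwartz (fun y => g (-y))) : Integrable g := by
  rw [← integrableOn_univ, ← Iic_union_Ioi (a := (0 : ℝ))]
  refine IntegrableOn.union ?_ hp.integrable
  have h := hq.integrable
  rw [integrableOn_Iic_iff_integrableOn_Iio]
  refine ((Measure.measurePreserving_neg volume).integrableOn_comp_preimage
    (Homeomorph.neg ℝ).measurableEmbedding).1 ?_
  rwa [show (Neg.neg ⁻¹' Iio (0 : ℝ)) = Ioi 0 by ext; simp]

lemma oscIntegral_eq_pairFourier {g : ℝ → ℂ} (hi : Integrable g) (x : ℝ) :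
    oscIntegral volume g x = pairFourier g (fun y => g (-y)) x := by
  have h := integral_comp_neg_Ioi (c := (0 : ℝ)) (f := fun y : ℝ => g y * cexp (I * x * y))
  have h2 := intervalIntegral.integral_Iic_add_Ioi (b := (0 : ℝ))
    (Integrable.mul_cexp hi x).integrableOn (Integrable.mul_cexp hi x).integrableOn
  rw [pairFourier, halfFourier, halfFourier, oscIntegral, oscIntegral, oscIntegral, ← h2, add_comm,
    ← neg_zero, ← h, neg_zero]
  congr 1
  refine integral_congr_ae (ae_of_all _ fun y => ?_)
  simp

theorem exists_kirillovMap_eq {e : ℕ} {f : PuncturedLine → ℂ} (hs : SmoothOffZero f)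
    (hr : RapidlyDecreasing f) (h0 : RegularAtZero (e + 1) f) :
    ∃ φ, InvSmooth (e + 2) φ ∧ kirillovMap (e + 1) φ = f := by
  obtain ⟨g, hg, hgr, hgl, hgd⟩ := h0
  rw [Nat.add_sub_cancel] at hgd
  set a : ℝ := (((e + 1 : ℕ) : ℝ) - 1) / 2 with ha
  have hgc : ContDiff ℝ e g := contDiff_iff_contDiffAt.2 fun y => by
    rcases lt_trichotomy y 0 with hy | rfl | hy
    · exact (hgl.contDiffAt (Iic_mem_nhds hy)).of_le (by exact_mod_cast le_top)
    · exact hgd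
    · exact (hgr.contDiffAt (Ici_mem_nhds hy)).of_le (by exact_mod_cast le_top)
  have hq' : ContDiffOn ℝ ∞ (fun y => g (-y)) (Ici 0) :=
    hgl.comp contDiff_neg.contDiffOn fun y hy => by simpa using hy
  have hp : HalfSchwartz g := by
    refine ⟨hgr, ((rapidDecay_of_bound (u := extendByZero f) fun k n => ?_).rpow_smul
      (hs.mono fun y hy => ne_of_gt hy) a).congr fun y hy => ?_⟩
    · obtain ⟨C, R, h⟩ := hr k n
      exact ⟨C, R, fun y hy => h y (hy.trans (le_abs_self y))⟩
    · have hy0 : y ≠ 0 := ne_of_gt hy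
      have := hg ⟨y, hy0⟩
      simp only [abs_of_pos (mem_Ioi.1 hy)] at this
      simp only [this, extendByZero_of_ne f hy0, real_smul]
  have hq : HalfSchwartz (fun y => g (-y)) := by
    refine ⟨hq', ((rapidDecay_of_bound (u := fun y => extendByZero f (-y)) fun k n => ?_).rpow_smul
      ?_ a).congr fun y hy => ?_⟩
    · obtain ⟨C, R, h⟩ := hr k n
      refine ⟨C, R, fun y hy => ?_⟩
      rw [iteratedDeriv_comp_neg, norm_smul, norm_pow, norm_neg, norm_one, one_pow, one_mul]
      have := h (-y) (by rw [abs_neg]; exact hy.trans (le_abs_self y))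
      rwa [abs_neg] at this
    · exact ContDiffOn.comp hs contDiff_neg.contDiffOn fun y hy => by
        simpa using ne_of_gt (mem_Ioi.1 hy)
    · have hy0 : -y ≠ 0 := neg_ne_zero.2 (ne_of_gt hy)
      have := hg ⟨-y, hy0⟩
      simp only [abs_neg, abs_of_pos (mem_Ioi.1 hy)] at this
      simp only [this, extendByZero_of_ne f hy0, real_smul]
  have hi := integrable_of_halfSchwartz hp hq
  have hG : oscIntegral volume g = pairFourier g (fun y => g (-y)) :=
    funext (oscIntegral_eq_pairFourier hi)
  have hI : InvSmooth (e + 2) (oscIntegral volume g) := by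
    rw [hG]
    exact invSmooth_pairFourier hgc hp hq (fun _ _ => rfl) (fun _ _ => rfl)
  set r : ℝ := (2 * Real.pi) ^ (-(1 / 2) : ℝ) with hr'
  have hrr : r * r * (2 * Real.pi) = 1 := by
    have : (0 : ℝ) < 2 * Real.pi := by positivity
    rw [hr', ← Real.rpow_add this]
    norm_num
    rw [Real.rpow_neg_one]
    field_simp
  refine ⟨_, hI.const_mul r, funext fun y => ?_⟩
  have hrc : (r : ℂ) * r * (2 * Real.pi) = 1 := by exact_mod_cast hrr
  rw [kirillovMap, unitaryFourier_eq, ← hr', oscIntegral_const_mul, oscIntegral_oscIntegral_neg hgc.continuous hi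
    (hI.of_le (by omega)).integrable, ← mul_assoc (r : ℂ), ← mul_assoc ((r : ℂ) * r), hrc, one_mul,
    hg, ← mul_assoc, ← ofReal_mul, ← Real.rpow_add (abs_pos.2 y.2), ha,
    show (1 - ((e + 1 : ℕ) : ℝ)) / 2 + (((e + 1 : ℕ) : ℝ) - 1) / 2 = 0 by ring, Real.rpow_zero,
    ofReal_one, one_mul]

theorem mainTheorem5 (d : ℕ) (hd : 1 ≤ d) :
    kirillovImage d =
      {f : PuncturedLine → ℂ | SmoothOffZero f ∧ RapidlyDecreasing f ∧ RegularAtZero d f} := by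
  obtain ⟨e, rfl⟩ := Nat.exists_eq_add_of_le' hd
  ext f
  constructor
  · rintro ⟨φ, hφ, rfl⟩
    exact kirillovMap_mem ((mem_inducedSpace_iff _ _).1 hφ)
  · rintro ⟨h1, h2, h3⟩
    obtain ⟨φ, hφ, e⟩ := exists_kirillovMap_eq h1 h2 h3
    exact ⟨φ, (mem_inducedSpace_iff _ _).2 hφ, e⟩
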